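/- Let $\Omega\subset\mathbb{R}^n$ be nonempty, closed and convex, and let $F:\Omega\to\mathbb{R}^n$ be continuous and monotone, i.e. $\langle F(x)-F(y),x-y\rangle\ge 0$ for all $x,y\in\Omega$. Let $S_0=\{\bar x\in\Omega:\ \langle F(\bar x),y-\bar x\rangle\ge 0\ \ \forall y\in\Omega\}$ be the solution set of the variational inequality $\mathrm{VI}(F,\Omega)$, and assume that $S_0$ is nonempty and closed. Let $\varphi:\mathbb{R}^n\to(-\infty,+\infty]$ be a convex function that is finite on $\Omega$ and whose restriction to $\Omega$ is continuous (for instance a continuous convex function $\varphi:\Omega\to\mathbb{R}$, extended by $+\infty$ outside $\Omega$). Let $\partial\varphi(x)=\{v\in\mathbb{R}^n:\ \varphi(y)\ge\varphi(x)+\langle v,y-x\rangle\ \ \forall y\in\mathbb{R}^n\}$ if $\varphi(x)<+\infty$ and $\partial\varphi(x)=\emptyset$ otherwise, and let $\operatorname{dom}\partial\varphi=\{x:\partial\varphi(x)\neq\emptyset\}$. Assume that $$0\in\operatorname{ri}(\operatorname{dom}\partial\varphi-\Omega)\qquad\text{and}\qquad 0\in\operatorname{ri}(\operatorname{dom}\partial\varphi-S_0),$$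 where $\operatorname{ri}$ denotes the relative interior (the interior relative to the affine hull) and $A-B=\{a-b: a\in A,\ b\in B\}$. Let $$S_\varphi=\{\bar x\in S_0:\ \exists v\in\partial\varphi(\bar x)\ \text{ with }\ \langle v,x-\bar x\rangle\ge 0\ \ \forall x\in S_0\}$$ be the solution set of the generalized variational inequality $\mathrm{GVI}(\partial\varphi,S_0)$, and let $S_0^\infty=\{w\in\mathbb{R}^n:\ x+\tau w\in S_0\ \ \forall x\in S_0,\ \forall\tau\ge 0\}$ be the recession cone of $S_0$. Then $S_\varphi=\operatorname{argmin}_{S_0}\varphi$. Moreover, $S_\varphi$ is nonempty, bounded and convex if and only if for every $w\in S_0^\infty\setminus\{0\}$ there are $x\in S_0$ and $v\in\partial\varphi(x)$ with $\langle v,w\rangle>0$. -/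

import Mathlib

/-!
By Minty's lemma the solution set of a continuous monotone variational inequality is an intersection
of half-spaces with `Ω`, hence convex, and this is all that `F` contributes: `S₀` may be any closed
convex subset `S` of `D`.

The qualification condition makes `0` a relative algebraic interior point of `D - S`. At a minimizer
`x` of `φ` over `S`, the convex set of all `(d - s, t)` with `φ d - φ x ≤ t` therefore has a
nonvertical supporting hyperplane at the origin; its slope is a subgradient `v` of `φ` at `x` with
`⟪v, s - x⟫ ≥ 0` on `S`.

If a sublevel set of `φ` on `S` is unbounded, it has an asymptotic direction `w`, and a subgradient
inequality with `⟪v, w⟫ > 0` would force `φ` to exceed its level along it. Conversely, if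
`⟪v, w⟫ ≤ 0` for all subgradients on `S`, then `φ` does not increase along `w`, so the set of
minimizers contains a ray as soon as it is nonempty. Subgradients may be missing at points of `S`;
they exist on the relative interior of `D`, which meets `S`, and lower semicontinuity does the rest.
-/

open scoped Pointwise

namespace VarIneq

variable {n : ℕ}

/-- `F` is monotone on `Ω`: `⟨F x - F y, x - y⟩ ≥ 0` for all `x, y ∈ Ω`. -/
def MonotoneMapOn (F : EuclideanSpace ℝ (Fin n) → EuclideanSpace ℝ (Fin n))
    (Ω : Set (EuclideanSpace ℝ (Fin n))) : Prop :=
  ∀ x ∈ Ω, ∀ y ∈ Ω, 0 ≤ inner ℝ (F x - F y) (x - y)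

/-- Solution set of the variational inequality `VI(F, Ω)`. -/
def solVI (F : EuclideanSpace ℝ (Fin n) → EuclideanSpace ℝ (Fin n))
    (Ω : Set (EuclideanSpace ℝ (Fin n))) : Set (EuclideanSpace ℝ (Fin n)) :=
  {x | x ∈ Ω ∧ ∀ y ∈ Ω, 0 ≤ inner ℝ (F x) (y - x)}

/-- Solution set of the (strong) generalized variational inequality `GVI(T, Ω)` of a
set-valued map `T`. -/
def solGVI (T : EuclideanSpace ℝ (Fin n) → Set (EuclideanSpace ℝ (Fin n)))
    (Ω : Set (EuclideanSpace ℝ (Fin n))) : Set (EuclideanSpace ℝ (Fin n)) :=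
  {x | x ∈ Ω ∧ ∃ v ∈ T x, ∀ y ∈ Ω, 0 ≤ inner ℝ v (y - x)}

/-- Recession (asymptotic) cone of `Ω`. -/
def recessionCone (Ω : Set (EuclideanSpace ℝ (Fin n))) : Set (EuclideanSpace ℝ (Fin n)) :=
  {w | ∀ x ∈ Ω, ∀ τ : ℝ, 0 ≤ τ → x + τ • w ∈ Ω}

/-- Convex subdifferential at `x` of the extended-valued function that equals `φ` on its effective
domain `D` and `+∞` outside `D`. It is empty at points outside `D`. -/
def subdiff (D : Set (EuclideanSpace ℝ (Fin n))) (φ : EuclideanSpace ℝ (Fin n) → ℝ)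
    (x : EuclideanSpace ℝ (Fin n)) : Set (EuclideanSpace ℝ (Fin n)) :=
  {v | x ∈ D ∧ ∀ y ∈ D, φ x + inner ℝ v (y - x) ≤ φ y}

/-- Domain of a set-valued map. -/
def svDom (T : EuclideanSpace ℝ (Fin n) → Set (EuclideanSpace ℝ (Fin n))) :
    Set (EuclideanSpace ℝ (Fin n)) :=
  {x | (T x).Nonempty}

/-- Set of minimizers of `φ` over `S`. -/
def argminOn (φ : EuclideanSpace ℝ (Fin n) → ℝ) (S : Set (EuclideanSpace ℝ (Fin n))) :
    Set (EuclideanSpace ℝ (Fin n)) :=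
  {x | x ∈ S ∧ ∀ y ∈ S, φ x ≤ φ y}

end VarIneq

open Filter Topology AffineSpace

namespace VarIneq

section RelCore

variable {E : Type*} [AddCommGroup E] [Module ℝ E] {A D S : Set E} {φ : E → ℝ} {x y : E}

/-- The relative algebraic interior of `A`: the points beyond which every segment of `A` can be
prolonged inside `A`. For convex sets in finite dimension it is the relative interior; in this form
it makes sense in any real vector space, without topology or affine spans. -/
def relCore (A : Set E) : Set E :=
  {x | x ∈ A ∧ ∀ y ∈ A, ∃ ε : ℝ, 0 < ε ∧ x + ε • (x - y) ∈ A}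

theorem relCore_subset : relCore A ⊆ A := fun _ hx => hx.1

theorem zero_mem_relCore_sub_singleton (hx : x ∈ relCore A) : 0 ∈ relCore (A - {x}) := by
  rw [Set.sub_singleton]
  refine ⟨⟨x, hx.1, sub_self x⟩, ?_⟩
  rintro _ ⟨y, hy, rfl⟩
  obtain ⟨ε, hε, hmem⟩ := hx.2 y hy
  exact ⟨ε, hε, _, hmem, by module⟩

theorem lineMap_mem_relCore (hA : Convex ℝ A) (hx : x ∈ relCore A) (hy : y ∈ A) {t : ℝ}
    (ht : t ∈ Set.Ioc (0 : ℝ) 1) : AffineMap.lineMap y x t ∈ relCore A := by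
  obtain ⟨ht0, ht1⟩ := ht
  refine ⟨hA.lineMap_mem hy hx.1 ⟨ht0.le, ht1⟩, fun z hz => ?_⟩
  obtain ⟨ε, hε, hmem⟩ := hx.2 z hz
  have hpos : 0 < 1 + ε * (1 - t) := by nlinarith
  refine ⟨t * ε / (1 + ε * (1 - t)), by positivity, ?_⟩
  -- The prolonged point lies on the segment from `y` to the prolongation `x + ε • (x - z)`.
  convert! hA.lineMap_mem hy hmem (t := t / (1 + ε * (1 - t)))
    ⟨by positivity, by rw [div_le_one hpos]; nlinarith⟩ using 1
  simp only [AffineMap.lineMap_apply_module']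
  match_scalars <;> field_simp <;> ring

theorem sub_subset_affineSpan_relCore_sub (hD : Convex ℝ D) (hne : (relCore D).Nonempty) :
    D - S ⊆ affineSpan ℝ (relCore D - S) := by
  obtain ⟨x, hx⟩ := hne
  rintro _ ⟨d, hd, s, hs, rfl⟩
  have hmid : AffineMap.lineMap d x (1 / 2 : ℝ) ∈ relCore D :=
    lineMap_mem_relCore hD hx hd (by norm_num)
  convert! AffineMap.lineMap_mem (k := ℝ) 2
    (subset_affineSpan ℝ _ (Set.sub_mem_sub hx hs))
    (subset_affineSpan ℝ _ (Set.sub_mem_sub hmid hs)) using 1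
  simp only [AffineMap.lineMap_apply_module']
  module

theorem inter_relCore_nonempty (hS : Convex ℝ S) (hD : Convex ℝ D) (hne : (relCore D).Nonempty)
    (h0 : 0 ∈ relCore (D - S)) : (S ∩ relCore D).Nonempty := by
  obtain ⟨x, hx⟩ := hne
  obtain ⟨-, -, s, hs, -⟩ := h0.1
  obtain ⟨ε, hε, d', hd', s', hs', heq⟩ := h0.2 _ (Set.sub_mem_sub (relCore_subset hx) hs)
  have ht : ε / (1 + ε) ∈ Set.Ioc (0 : ℝ) 1 :=
    ⟨by positivity, by rw [div_le_one (by positivity)]; linarith⟩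
  -- `d' - s' = -ε • (x - s)` says that the segments `[d', x]` and `[s', s]` cross.
  have hcross : AffineMap.lineMap s' s (ε / (1 + ε)) = AffineMap.lineMap d' x (ε / (1 + ε)) := by
    obtain rfl : d' = s' + (0 + ε • (0 - (x - s))) := sub_eq_iff_eq_add'.1 heq
    simp only [AffineMap.lineMap_apply_module']
    match_scalars <;> field_simp <;> ring
  exact ⟨_, hS.lineMap_mem hs' hs ⟨ht.1.le, ht.2⟩, hcross ▸ lineMap_mem_relCore hD hx hd' ht⟩

theorem span_le_hull_of_zero_mem_relCore (h0 : 0 ∈ relCore A) :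
    (Submodule.span ℝ A : PointedCone ℝ E) ≤ PointedCone.hull ℝ A := by
  refine (PointedCone.gc_ofSubmodule_lineal _ _).2 (Submodule.span_le.2 fun a ha => ?_)
  refine PointedCone.mem_lineal.2 ⟨PointedCone.subset_hull ha, ?_⟩
  obtain ⟨ε, hε, hmem⟩ := h0.2 a ha
  rw [← PointedCone.smul_mem_iff _ hε]
  simpa using PointedCone.subset_hull (R := ℝ) hmem

theorem exists_linearMap_fst_le_snd {C : Set (E × ℝ)} (hC : Convex ℝ C) (hC0 : (0, 0) ∈ C)
    (h0 : 0 ∈ relCore (Prod.fst '' C)) (hnonneg : ∀ t : ℝ, (0, t) ∈ C → 0 ≤ t) :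
    ∃ f : E →ₗ[ℝ] ℝ, ∀ p ∈ C, f p.1 ≤ p.2 := by
  let K : PointedCone ℝ (E × ℝ) :=
    (ConvexCone.hull ℝ C).toPointedCone (ConvexCone.subset_hull hC0)
  have hCK : C ⊆ K := ConvexCone.subset_hull
  let W : Submodule ℝ E := Submodule.span ℝ (Prod.fst '' C)
  have hW_le : (W : PointedCone ℝ E) ≤ K.map (LinearMap.fst ℝ E ℝ) :=
    (span_le_hull_of_zero_mem_relCore h0).trans (Submodule.span_le.2 (Set.image_mono hCK))
  obtain ⟨W', hW'⟩ := W.exists_isCompl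
  -- `W'` is adjoined to the vertical axis because the Riesz extension theorem needs the domain of
  -- the functional and the cone to add up to the whole space.
  let snd' : E × ℝ →ₗ.[ℝ] ℝ := ⟨W'.prod ⊤, (LinearMap.snd ℝ E ℝ).comp (W'.prod ⊤).subtype⟩
  obtain ⟨g, hg, hgK⟩ := riesz_extension K snd'
    (by
      rintro ⟨p, hW'_mem, _⟩ (hK : p ∈ K)
      obtain ⟨c, hc, ⟨u, t⟩, hmem, rfl⟩ := (ConvexCone.mem_hull_of_convex hC).1 hK
      have huW : u ∈ W := Submodule.subset_span ⟨_, hmem, rfl⟩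
      have huW' : u ∈ W' := (W'.smul_mem_iff hc.ne').1 hW'_mem
      obtain rfl : u = 0 := Submodule.disjoint_def.1 hW'.disjoint u huW huW'
      exact mul_nonneg hc.le (hnonneg t hmem))
    (by
      rintro ⟨u, r⟩
      have hu : u ∈ W ⊔ W' := hW'.sup_eq_top ▸ Submodule.mem_top
      obtain ⟨w, hw, w', hw', rfl⟩ := Submodule.mem_sup.1 hu
      obtain ⟨⟨_, t⟩, ht, rfl⟩ := hW_le hw
      refine ⟨⟨(-w', t - r), W'.neg_mem hw', trivial⟩, ?_⟩
      convert! ht using 1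
      ext <;> simp)
  refine ⟨-(g.comp (LinearMap.inl ℝ E ℝ)), fun p hp => ?_⟩
  have hsnd : g (0, p.2) = p.2 := hg ⟨(0, p.2), W'.zero_mem, trivial⟩
  have hsplit : g p = g (p.1, 0) + g (0, p.2) := by rw [← map_add]; simp
  have hgp := hgK p (hCK hp)
  simp only [LinearMap.neg_apply, LinearMap.comp_apply, LinearMap.inl_apply]
  linarith

/-- Taking `s = x` makes `f` a subgradient of `φ` at `x`, and `d = x` makes it nonnegative on
`S - x`: this is the sum rule `0 ∈ ∂φ(x) + N_S(x)` in one inequality. -/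
theorem exists_linearMap_le_of_isMinOn (hφ : ConvexOn ℝ D φ) (hS : Convex ℝ S)
    (h0 : 0 ∈ relCore (D - S)) (hxD : x ∈ D) (hxS : x ∈ S) (hmin : IsMinOn φ (D ∩ S) x) :
    ∃ f : E →ₗ[ℝ] ℝ, ∀ d ∈ D, ∀ s ∈ S, φ x + f (d - s) ≤ φ d := by
  let C : Set (E × ℝ) := {p | p.1 ∈ D ∧ φ p.1 ≤ p.2} - S ×ˢ {φ x}
  have mem_C {d s : E} (hd : d ∈ D) (hs : s ∈ S) : (d - s, φ d - φ x) ∈ C :=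
    ⟨(d, φ d), ⟨hd, le_rfl⟩, (s, φ x), ⟨hs, rfl⟩, rfl⟩
  have hC : Convex ℝ C := hφ.convex_epigraph.sub (hS.prod (convex_singleton _))
  have hfst : Prod.fst '' C = D - S := by
    ext u
    constructor
    · rintro ⟨_, ⟨p, hp, q, hq, rfl⟩, rfl⟩
      exact Set.sub_mem_sub hp.1 hq.1
    · rintro ⟨d, hd, s, hs, rfl⟩
      exact ⟨_, mem_C hd hs, rfl⟩
  have hnonneg (t : ℝ) (ht : (0, t) ∈ C) : 0 ≤ t := by
    obtain ⟨⟨d, r⟩, ⟨hd, hdr⟩, ⟨s, m⟩, ⟨hs, rfl⟩, heq⟩ := ht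
    obtain ⟨hds, rfl⟩ := Prod.mk.inj heq
    obtain rfl := sub_eq_zero.1 hds
    exact sub_nonneg.2 ((hmin ⟨hd, hs⟩).trans hdr)
  have hC0 : (0, 0) ∈ C := by simpa only [sub_self] using mem_C hxD hxS
  obtain ⟨f, hf⟩ := exists_linearMap_fst_le_snd hC hC0 (hfst ▸ h0) hnonneg
  exact ⟨f, fun d hd s hs => by linarith [hf _ (mem_C hd hs)]⟩

end RelCore

section TopologicalVectorSpace

variable {E : Type*} [AddCommGroup E] [Module ℝ E] [TopologicalSpace E] [IsTopologicalAddGroup E]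
  [ContinuousSMul ℝ E] {A B S : Set E} {x w z : E}

theorem mem_relCore_of_mem_intrinsicInterior (hx : x ∈ intrinsicInterior ℝ A) (hAB : A ⊆ B)
    (hB : B ⊆ affineSpan ℝ A) : x ∈ relCore B := by
  refine ⟨hAB (intrinsicInterior_subset hx), fun y hy => ?_⟩
  obtain ⟨x', hx', rfl⟩ := mem_intrinsicInterior.1 hx
  let ray : ℝ → affineSpan ℝ A := fun t =>
    ⟨AffineMap.lineMap (x' : E) y (-t), AffineMap.lineMap_mem _ x'.2 (hB hy)⟩
  have hray : Continuous ray :=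
    (AffineMap.lineMap_continuous.comp continuous_neg).subtype_mk _
  have hray0 : ray 0 = x' := by ext; simp [ray]
  have hev : ∀ᶠ t in 𝓝[>] (0 : ℝ), (ray t : E) ∈ A :=
    ((hray.tendsto' 0 x' hray0).eventually (mem_interior_iff_mem_nhds.1 hx')).filter_mono
      nhdsWithin_le_nhds
  obtain ⟨ε, hmem, hε⟩ := (hev.and self_mem_nhdsWithin).exists
  refine ⟨ε, hε, hAB ?_⟩
  convert! hmem using 1
  simp only [ray, AffineMap.lineMap_apply_module']
  module

theorem le_of_lowerSemicontinuousOn_of_lineMap_le {f : E → ℝ} (hf : LowerSemicontinuousOn f S)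
    (hS : Convex ℝ S) (hx : x ∈ S) (hz : z ∈ S) {a b : ℝ}
    (hle : ∀ t ∈ Set.Ioo (0 : ℝ) 1, f (AffineMap.lineMap x z t) ≤ AffineMap.lineMap a b t) :
    f x ≤ a := by
  by_contra! hlt
  obtain ⟨c, hac, hcf⟩ := exists_between hlt
  have hseg : Tendsto (AffineMap.lineMap x z : ℝ → E) (𝓝[>] 0) (𝓝[S] x) := by
    refine tendsto_nhdsWithin_iff.2 ⟨?_, ?_⟩
    · exact (AffineMap.lineMap_continuous.tendsto' 0 x (by simp)).mono_left nhdsWithin_le_nhds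
    · filter_upwards [Ioo_mem_nhdsGT (zero_lt_one' ℝ)] with t ht
      exact hS.lineMap_mem hx hz ⟨ht.1.le, ht.2.le⟩
  have hbound : Tendsto (AffineMap.lineMap a b : ℝ → ℝ) (𝓝[>] 0) (𝓝 a) :=
    (AffineMap.lineMap_continuous.tendsto' 0 a (by simp)).mono_left nhdsWithin_le_nhds
  obtain ⟨t, hcft, htc, ht⟩ := ((hseg.eventually (hf x hx c hcf)).and
    ((hbound.eventually_lt_const hac).and (Ioo_mem_nhdsGT (zero_lt_one' ℝ)))).exists
  linarith [hle t ht]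

theorem mem_asymptoticCone_of_forall_add_smul_mem (h : ∀ τ : ℝ, 0 ≤ τ → x + τ • w ∈ A) :
    w ∈ asymptoticCone ℝ A := by
  have hray : Tendsto (fun τ : ℝ => τ • w +ᵥ x) atTop (asymptoticNhds ℝ E w) :=
    (tendsto_id.atTop_smul_const_tendsto_asymptoticNhds w).asymptoticNhds_vadd_const x
  refine mem_asymptoticCone_iff.2 (hray.frequently (Eventually.frequently ?_))
  filter_upwards [eventually_ge_atTop 0] with τ hτ
  rw [vadd_eq_add, add_comm]
  exact h τ hτ

theorem nonpos_of_mem_asymptoticCone (f : E →L[ℝ] ℝ) (hf : BddAbove (f '' A))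
    (hw : w ∈ asymptoticCone ℝ A) : f w ≤ 0 := by
  by_contra! hpos
  obtain ⟨c, hc⟩ := hf
  have htend : Tendsto f (asymptoticNhds ℝ E w) atTop := by
    rw [asymptoticNhds_eq_smul, ← map₂_smul, ← map_prod_eq_map₂, tendsto_map'_iff]
    simpa only [Function.comp_def, map_smul, smul_eq_mul] using
      tendsto_fst.atTop_mul_pos hpos ((f.continuous.tendsto w).comp tendsto_snd)
  obtain ⟨y, hyA, hcy⟩ :=
    ((mem_asymptoticCone_iff.1 hw).and_eventually (htend.eventually_gt_atTop c)).exists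
  exact hcy.not_ge (hc ⟨y, hyA, rfl⟩)

end TopologicalVectorSpace

theorem relCore_nonempty {E : Type*} [NormedAddCommGroup E] [NormedSpace ℝ E]
    [FiniteDimensional ℝ E] {A : Set E} (hA : Convex ℝ A) (hne : A.Nonempty) :
    (relCore A).Nonempty := by
  obtain ⟨x, hx⟩ := hne.intrinsicInterior hA
  exact ⟨x, mem_relCore_of_mem_intrinsicInterior hx subset_rfl (subset_affineSpan ℝ A)⟩

theorem exists_inner_le_of_isMinOn {E : Type*} [NormedAddCommGroup E] [InnerProductSpace ℝ E]
    [FiniteDimensional ℝ E] {D S : Set E} {φ : E → ℝ} (hφ : ConvexOn ℝ D φ) (hS : Convex ℝ S)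
    (h0 : 0 ∈ relCore (D - S)) {x : E} (hxD : x ∈ D) (hxS : x ∈ S)
    (hmin : IsMinOn φ (D ∩ S) x) :
    ∃ v : E, ∀ d ∈ D, ∀ s ∈ S, φ x + inner ℝ v (d - s) ≤ φ d := by
  obtain ⟨f, hf⟩ := exists_linearMap_le_of_isMinOn hφ hS h0 hxD hxS hmin
  refine ⟨(InnerProductSpace.toDual ℝ E).symm f.toContinuousLinearMap, fun d hd s hs => ?_⟩
  simpa using hf d hd s hs

variable {n : ℕ} {D S Ω : Set (EuclideanSpace ℝ (Fin n))}
  {F : EuclideanSpace ℝ (Fin n) → EuclideanSpace ℝ (Fin n)} {φ : EuclideanSpace ℝ (Fin n) → ℝ}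

section VariationalInequality

theorem solVI_subset : solVI F Ω ⊆ Ω := fun _ hx => hx.1

theorem mem_solVI_iff_minty (hΩ : Convex ℝ Ω) (hF : ContinuousOn F Ω) (hmono : MonotoneMapOn F Ω)
    {x : EuclideanSpace ℝ (Fin n)} :
    x ∈ solVI F Ω ↔ x ∈ Ω ∧ ∀ y ∈ Ω, 0 ≤ inner ℝ (F y) (y - x) := by
  refine ⟨fun ⟨hx, h⟩ => ⟨hx, fun y hy => ?_⟩, fun ⟨hx, h⟩ => ⟨hx, fun y hy => ?_⟩⟩
  · have hxy := hmono y hy x hx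
    rw [inner_sub_left] at hxy
    linarith [h y hy]
  · have hseg : ∀ᶠ t in 𝓝[>] (0 : ℝ), x + t • (y - x) ∈ Ω := by
      filter_upwards [Ioo_mem_nhdsGT (zero_lt_one' ℝ)] with t ht
      exact hΩ.add_smul_sub_mem hx hy ⟨ht.1.le, ht.2.le⟩
    have hpath : Tendsto (fun t : ℝ => x + t • (y - x)) (𝓝[>] 0) (𝓝[Ω] x) :=
      tendsto_nhdsWithin_iff.2 ⟨(Continuous.tendsto' (by fun_prop) 0 x (by simp)).mono_left
        nhdsWithin_le_nhds, hseg⟩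
    have hlim : Tendsto (fun t : ℝ => inner ℝ (F (x + t • (y - x))) (y - x)) (𝓝[>] 0)
        (𝓝 (inner ℝ (F x) (y - x))) :=
      ((hF x hx).tendsto.comp hpath).inner tendsto_const_nhds
    refine ge_of_tendsto hlim ?_
    filter_upwards [hseg, self_mem_nhdsWithin] with t hmem ht
    have hinner := h _ hmem
    rw [add_sub_cancel_left, inner_smul_right] at hinner
    exact nonneg_of_mul_nonneg_right hinner ht

theorem convex_solVI (hΩ : Convex ℝ Ω) (hF : ContinuousOn F Ω) (hmono : MonotoneMapOn F Ω) :
    Convex ℝ (solVI F Ω) := by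
  have heq : solVI F Ω = Ω ∩ ⋂ y ∈ Ω, {x | inner ℝ (F y) x ≤ inner ℝ (F y) y} := by
    ext x
    simp [mem_solVI_iff_minty hΩ hF hmono, inner_sub_right]
  rw [heq]
  exact hΩ.inter (convex_iInter₂ fun y _ => convex_halfSpace_le (innerSL ℝ (F y)).isLinear _)

end VariationalInequality

section Subdifferential

theorem svDom_subdiff_subset : svDom (subdiff D φ) ⊆ D := fun _ ⟨_, hv⟩ => hv.1

theorem relCore_subset_svDom_subdiff (hφ : ConvexOn ℝ D φ) :
    relCore D ⊆ svDom (subdiff D φ) := by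
  intro x hx
  obtain ⟨v, hv⟩ := exists_inner_le_of_isMinOn hφ (convex_singleton x)
    (zero_mem_relCore_sub_singleton hx) hx.1 rfl fun y hy => (congrArg φ hy.2).ge
  exact ⟨v, hx.1, fun y hy => hv y hy x rfl⟩

theorem zero_mem_relCore_sub (hφ : ConvexOn ℝ D φ)
    (hri : (0 : EuclideanSpace ℝ (Fin n)) ∈ intrinsicInterior ℝ (svDom (subdiff D φ) - S)) :
    0 ∈ relCore (D - S) := by
  obtain ⟨d, hd, -⟩ := intrinsicInterior_subset hri
  have hne : (relCore D).Nonempty := relCore_nonempty hφ.1 ⟨d, svDom_subdiff_subset hd⟩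
  have hspan : D - S ⊆ affineSpan ℝ (svDom (subdiff D φ) - S) :=
    (sub_subset_affineSpan_relCore_sub hφ.1 hne).trans
      (affineSpan_mono ℝ (Set.sub_subset_sub_right (relCore_subset_svDom_subdiff hφ)))
  exact mem_relCore_of_mem_intrinsicInterior hri (Set.sub_subset_sub_right svDom_subdiff_subset)
    hspan

theorem solGVI_subdiff_eq_argminOn (hφ : ConvexOn ℝ D φ) (hS : Convex ℝ S) (hSD : S ⊆ D)
    (h0 : 0 ∈ relCore (D - S)) : solGVI (subdiff D φ) S = argminOn φ S := by
  ext x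
  constructor
  · rintro ⟨hx, v, hv, hinner⟩
    exact ⟨hx, fun y hy => by linarith [hv.2 y (hSD hy), hinner y hy]⟩
  · rintro ⟨hx, hmin⟩
    obtain ⟨v, hv⟩ := exists_inner_le_of_isMinOn hφ hS h0 (hSD hx) hx fun y hy => hmin y hy.2
    refine ⟨hx, v, ⟨hSD hx, fun y hy => hv y hy x hx⟩, fun y hy => ?_⟩
    have hnormal := hv x (hSD hx) y hy
    rw [← neg_sub, inner_neg_right] at hnormal
    linarith

theorem convex_argminOn (hφ : ConvexOn ℝ S φ) : Convex ℝ (argminOn φ S) :=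
  fun _ hx _ hy _ _ ha hb hab =>
    ⟨hφ.1 hx.1 hy.1 ha hb hab, fun z hz =>
      (hφ.convex_le (φ z) ⟨hx.1, hx.2 z hz⟩ ⟨hy.1, hy.2 z hz⟩ ha hb hab).2⟩

end Subdifferential

section Recession

variable {w : EuclideanSpace ℝ (Fin n)}

theorem asymptoticCone_subset_recessionCone (hS : Convex ℝ S) (hS_closed : IsClosed S) :
    asymptoticCone ℝ S ⊆ recessionCone S := fun w hw x hx τ hτ => by
  simpa only [vadd_eq_add, add_comm] using
    hS.smul_vadd_mem_of_isClosed_of_mem_asymptoticCone hS_closed hτ hw hx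

theorem le_of_forall_inner_subdiff_nonpos (hφ : ConvexOn ℝ D φ) (hS : Convex ℝ S) (hSD : S ⊆ D)
    (hφ_lsc : LowerSemicontinuousOn φ S) (h0 : 0 ∈ relCore (D - S)) (hw : w ∈ recessionCone S)
    (hsub : ∀ x ∈ S, ∀ v ∈ subdiff D φ x, inner ℝ v w ≤ 0) {x : EuclideanSpace ℝ (Fin n)}
    (hx : x ∈ S) {τ : ℝ} (hτ : 0 ≤ τ) : φ (x + τ • w) ≤ φ x := by
  obtain ⟨z, hzS, hz⟩ := inter_relCore_nonempty hS hφ.1 (relCore_nonempty hφ.1 ⟨x, hSD hx⟩) h0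
  have hxw : x + τ • w ∈ S := hw x hx τ hτ
  -- `φ` may lack subgradients at `x + τ • w`, but has them along the segment towards `z`.
  refine le_of_lowerSemicontinuousOn_of_lineMap_le hφ_lsc hS hxw hzS (b := φ z) fun t ht => ?_
  have ht' : t ∈ Set.Icc (0 : ℝ) 1 := ⟨ht.1.le, ht.2.le⟩
  obtain ⟨v, hv⟩ := relCore_subset_svDom_subdiff hφ
    (lineMap_mem_relCore hφ.1 hz (hSD hxw) ⟨ht.1, ht.2.le⟩)
  have hvw : inner ℝ v w ≤ 0 := hsub _ (hS.lineMap_mem hxw hzS ht') v hv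
  have hshift : AffineMap.lineMap x z t - AffineMap.lineMap (x + τ • w) z t =
      -(((1 - t) * τ) • w) := by
    simp only [AffineMap.lineMap_apply_module']
    module
  calc φ (AffineMap.lineMap (x + τ • w) z t)
      ≤ φ (AffineMap.lineMap x z t) := by
        have hgrad := hv.2 _ (hSD (hS.lineMap_mem hx hzS ht'))
        rw [hshift, inner_neg_right, inner_smul_right] at hgrad
        nlinarith [mul_nonneg (sub_nonneg.2 ht'.2) hτ]
    _ ≤ AffineMap.lineMap (φ x) (φ z) t := by
        simpa only [AffineMap.lineMap_apply_module] using
          hφ.2 (hSD hx) (hSD hzS) (sub_nonneg.2 ht'.2) ht'.1 (sub_add_cancel 1 t)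

theorem exists_inner_subdiff_pos (hφ : ConvexOn ℝ D φ) (hS : Convex ℝ S) (hSD : S ⊆ D)
    (hφ_lsc : LowerSemicontinuousOn φ S) (h0 : 0 ∈ relCore (D - S))
    (hne : (argminOn φ S).Nonempty) (hbdd : Bornology.IsBounded (argminOn φ S))
    (hw : w ∈ recessionCone S) (hw0 : w ≠ 0) :
    ∃ x ∈ S, ∃ v ∈ subdiff D φ x, 0 < inner ℝ v w := by
  by_contra! hsub
  obtain ⟨x, hx, hmin⟩ := hne
  have hray (τ : ℝ) (hτ : 0 ≤ τ) : x + τ • w ∈ argminOn φ S :=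
    ⟨hw x hx τ hτ, fun y hy => (le_of_forall_inner_subdiff_nonpos hφ hS hSD hφ_lsc h0 hw hsub
      hx hτ).trans (hmin y hy)⟩
  exact hw0 (asymptoticCone_subset_singleton_of_bounded hbdd
    (mem_asymptoticCone_of_forall_add_smul_mem hray))

theorem isBounded_sublevel (hS : Convex ℝ S) (hS_closed : IsClosed S) (hSD : S ⊆ D)
    (hpos : ∀ w ∈ recessionCone S, w ≠ 0 → ∃ x ∈ S, ∃ v ∈ subdiff D φ x, 0 < inner ℝ v w)
    (r : ℝ) : Bornology.IsBounded (S ∩ φ ⁻¹' Set.Iic r) := by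
  by_contra hunbdd
  obtain ⟨w, hw0, hw⟩ := not_bounded_iff_exists_ne_zero_mem_asymptoticCone.1 hunbdd
  have hwS : w ∈ recessionCone S :=
    asymptoticCone_subset_recessionCone hS hS_closed (asymptoticCone_mono Set.inter_subset_left hw)
  obtain ⟨x, -, v, hv, hvw⟩ := hpos w hwS hw0
  have hbdd : BddAbove (innerSL ℝ v '' (S ∩ φ ⁻¹' Set.Iic r)) := by
    refine ⟨r - φ x + inner ℝ v x, ?_⟩
    rintro _ ⟨y, ⟨hyS, hyr : φ y ≤ r⟩, rfl⟩
    have hgrad := hv.2 y (hSD hyS)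
    rw [inner_sub_right] at hgrad
    rw [innerSL_apply_apply]
    linarith
  exact hvw.not_ge (nonpos_of_mem_asymptoticCone (innerSL ℝ v) hbdd hw)

theorem argminOn_nonempty_of_isBounded_sublevel (hS_closed : IsClosed S)
    (hφ_lsc : LowerSemicontinuousOn φ S) {x₀ : EuclideanSpace ℝ (Fin n)} (hx₀ : x₀ ∈ S)
    (hbdd : Bornology.IsBounded (S ∩ φ ⁻¹' Set.Iic (φ x₀))) : (argminOn φ S).Nonempty := by
  have hclosed : IsClosed (S ∩ φ ⁻¹' Set.Iic (φ x₀)) := by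
    obtain ⟨V, hV, heq⟩ := lowerSemicontinuousOn_iff_preimage_Iic.1 hφ_lsc (φ x₀)
    exact heq ▸ hS_closed.inter hV
  have hne : (S ∩ φ ⁻¹' Set.Iic (φ x₀)).Nonempty := ⟨x₀, hx₀, le_refl (φ x₀)⟩
  obtain ⟨x, ⟨hxS, hx⟩, hmin⟩ := LowerSemicontinuousOn.exists_isMinOn hne
    (Metric.isCompact_of_isClosed_isBounded hclosed hbdd) (hφ_lsc.mono Set.inter_subset_left)
  refine ⟨x, hxS, fun y hy => ?_⟩
  rcases le_total (φ y) (φ x₀) with hle | hge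
  · exact hmin ⟨hy, hle⟩
  · exact le_trans hx hge

end Recession

end VarIneq

theorem mainTheorem12_general {n : ℕ} {S D : Set (EuclideanSpace ℝ (Fin n))}
    {φ : EuclideanSpace ℝ (Fin n) → ℝ} (hS : Convex ℝ S) (hS_closed : IsClosed S) (hSD : S ⊆ D)
    (hφ : ConvexOn ℝ D φ) (hφ_lsc : LowerSemicontinuousOn φ S)
    (hri : (0 : EuclideanSpace ℝ (Fin n)) ∈
      intrinsicInterior ℝ (VarIneq.svDom (VarIneq.subdiff D φ) - S)) :
    VarIneq.solGVI (VarIneq.subdiff D φ) S = VarIneq.argminOn φ S ∧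
      (((VarIneq.solGVI (VarIneq.subdiff D φ) S).Nonempty ∧
          Bornology.IsBounded (VarIneq.solGVI (VarIneq.subdiff D φ) S) ∧
          Convex ℝ (VarIneq.solGVI (VarIneq.subdiff D φ) S)) ↔
        ∀ w ∈ VarIneq.recessionCone S, w ≠ 0 →
          ∃ x ∈ S, ∃ v ∈ VarIneq.subdiff D φ x, 0 < inner ℝ v w) := by
  have h0 := VarIneq.zero_mem_relCore_sub hφ hri
  have heq := VarIneq.solGVI_subdiff_eq_argminOn hφ hS hSD h0
  refine ⟨heq, ?_⟩
  rw [heq]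
  constructor
  · rintro ⟨hne, hbdd, -⟩ w hw hw0
    exact VarIneq.exists_inner_subdiff_pos hφ hS hSD hφ_lsc h0 hne hbdd hw hw0
  · intro hpos
    obtain ⟨-, -, x₀, hx₀, -⟩ := intrinsicInterior_subset hri
    have hbdd := VarIneq.isBounded_sublevel hS hS_closed hSD hpos (φ x₀)
    exact ⟨VarIneq.argminOn_nonempty_of_isBounded_sublevel hS_closed hφ_lsc hx₀ hbdd,
      hbdd.subset fun x hx => ⟨hx.1, hx.2 x₀ hx₀⟩,
      VarIneq.convex_argminOn (hφ.subset hSD hS)⟩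

/-- `D ⊇ Ω` is the effective domain of the convex function `φ` (which is `+∞` outside `D`);
`D = Ω` is the case of a function given on `Ω` only. Relative interior is `intrinsicInterior`,
and the difference of sets is the Minkowski difference. -/
theorem mainTheorem12 {n : ℕ}
    (Ω D : Set (EuclideanSpace ℝ (Fin n)))
    (F : EuclideanSpace ℝ (Fin n) → EuclideanSpace ℝ (Fin n))
    (φ : EuclideanSpace ℝ (Fin n) → ℝ)
    (hΩ_ne : Ω.Nonempty) (hΩ_closed : IsClosed Ω) (hΩ_conv : Convex ℝ Ω)
    (hF_cont : ContinuousOn F Ω) (hF_mono : VarIneq.MonotoneMapOn F Ω)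
    (hΩD : Ω ⊆ D) (hφ_conv : ConvexOn ℝ D φ) (hφ_cont : ContinuousOn φ Ω)
    (hri_Ω : (0 : EuclideanSpace ℝ (Fin n)) ∈
      intrinsicInterior ℝ (VarIneq.svDom (VarIneq.subdiff D φ) - Ω))
    (hS_ne : (VarIneq.solVI F Ω).Nonempty) (hS_closed : IsClosed (VarIneq.solVI F Ω))
    (hri_S : (0 : EuclideanSpace ℝ (Fin n)) ∈
      intrinsicInterior ℝ (VarIneq.svDom (VarIneq.subdiff D φ) - VarIneq.solVI F Ω)) :
    VarIneq.solGVI (VarIneq.subdiff D φ) (VarIneq.solVI F Ω) =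
        VarIneq.argminOn φ (VarIneq.solVI F Ω) ∧
      (((VarIneq.solGVI (VarIneq.subdiff D φ) (VarIneq.solVI F Ω)).Nonempty ∧
          Bornology.IsBounded (VarIneq.solGVI (VarIneq.subdiff D φ) (VarIneq.solVI F Ω)) ∧
          Convex ℝ (VarIneq.solGVI (VarIneq.subdiff D φ) (VarIneq.solVI F Ω))) ↔
        ∀ w ∈ VarIneq.recessionCone (VarIneq.solVI F Ω), w ≠ 0 →
          ∃ x ∈ VarIneq.solVI F Ω, ∃ v ∈ VarIneq.subdiff D φ x, 0 < inner ℝ v w) :=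
  have hS := VarIneq.convex_solVI hΩ_conv hF_cont hF_mono
  mainTheorem12_general hS hS_closed (VarIneq.solVI_subset.trans hΩD) hφ_conv
    (hφ_cont.mono VarIneq.solVI_subset).lowerSemicontinuousOn hri_S
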